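/- For a non-negative integer $n$ let $$a_n(1,1)=\sum_{k=0}^n\binom nk\binom{n+k}k ,$$ let $n_0$ denote the $0$-th (least significant) digit in the ternary expansion of $n$, and let $\mu(n)$ denote the number of maximal strings of consecutive digits $2$ in the ternary expansion of $n$. Then, for every $n\ge 0$: 1. $a_n(1,1)\equiv 1\pmod 9$ if and only if the ternary expansion of $n$ contains only the digits $0$ and $2$, and $\mu(n)\equiv n_0\pmod 3$; 2. $a_n(1,1)\equiv 3\pmod 9$ if and only if $n_0=1$ and all other ternary digits of $n$ are $0$ or $2$; 3. $a_n(1,1)\equiv 4\pmod 9$ if and only if the ternary expansion of $n$ contains only the digits $0$ and $2$, and $\mu(n)\equiv n_0+2\pmod 3$; 4. $a_n(1,1)\equiv 6\pmod 9$ if and only if the ternary expansion of $n$ has exactly one occurrence of the string $11$ and otherwise contains only the digits $0$ and $2$; 5. $a_n(1,1)\equiv 7\pmod 9$ if and only if the ternary expansion of $n$ contains only the digits $0$ and $2$, and $\mu(n)\equiv n_0+1\pmod 3$; 6. if none of the conditions on the ternary expansion of $n$ in items 1-5 holds, then $a_n(1,1)$ is divisible by $9$; in particular, $a_n(1,1)\not\equiv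 2,5,8\pmod 9$ for all $n$. (The expansion of $n=0$ is regarded as containing only the digits $0$ and $2$.) -/

import Mathlib

/-- The (generalised) Apéry numbers `a_n(r, s) = ∑_{k=0}^n C(n,k)^r * C(n+k,k)^s`. -/
def aperyNumber (r s n : ℕ) : ℕ :=
  ∑ k ∈ Finset.range (n + 1), n.choose k ^ r * (n + k).choose k ^ s

/-- The digit `n_i` of `3^i` in the ternary expansion of `n` (it is `0` beyond the leading digit). -/
def ternaryDigit (n i : ℕ) : ℕ := (Nat.digits 3 n).getD i 0

/-- The ternary expansion of `n` contains only the digits `0` and `2`. -/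
def OnlyZerosAndTwos (n : ℕ) : Prop :=
  ∀ i, ternaryDigit n i = 0 ∨ ternaryDigit n i = 2

/-- The digits in the positions `i, i + 1, …, j` are all equal to `2`, and neither neighbouring
position holds a `2`: these positions form a maximal string of `2`'s. -/
abbrev IsMaximalStringOfTwos (n i j : ℕ) : Prop :=
  i ≤ j ∧ (∀ k ∈ Finset.Icc i j, ternaryDigit n k = 2) ∧
    (i = 0 ∨ ternaryDigit n (i - 1) ≠ 2) ∧ ternaryDigit n (j + 1) ≠ 2

/-- The number of maximal strings of `2`'s in the ternary expansion of `n`. -/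
def numMaximalStringsOfTwos (n : ℕ) : ℕ :=
  ((Finset.range (Nat.digits 3 n).length ×ˢ Finset.range (Nat.digits 3 n).length).filter
    fun p => IsMaximalStringOfTwos n p.1 p.2).card

/-- The `0`-th digit of `n` is `1` and all its other ternary digits are `0` or `2`. -/
def LastDigitOneOtherwiseZerosAndTwos (n : ℕ) : Prop :=
  ternaryDigit n 0 = 1 ∧ ∀ i, i ≠ 0 → ternaryDigit n i = 0 ∨ ternaryDigit n i = 2

/-- The string `11` occurs in the ternary expansion of `n` in the positions `i + 1, i`. -/
def OneOneOccursAt (n i : ℕ) : Prop :=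
  ternaryDigit n (i + 1) = 1 ∧ ternaryDigit n i = 1

/-- The ternary expansion of `n` has exactly one occurrence of the string `11`, and outside of this
occurrence it contains only the digits `0` and `2`. -/
def OneOneOnceOtherwiseZerosAndTwos (n : ℕ) : Prop :=
  ∃ i, OneOneOccursAt n i ∧ (∀ j, OneOneOccursAt n j → j = i) ∧
    ∀ j, j ≠ i → j ≠ i + 1 → ternaryDigit n j = 0 ∨ ternaryDigit n j = 2

/-! Since `n.choose k = coeff k ((X + 1) ^ n)`, the number `a_n(1,1)` is the coefficient of `X ^ n`
in `((X + 1) * (X + 2)) ^ n = ((X ^ 2 + 2) + 3 * X) ^ n`. Modulo `9` only the terms of degree at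
most `1` in `3 * X` survive, which gives `a_{2k} ≡ 2^k C(2k,k)` and
`a_{2k+1} ≡ 3 (2k+1) 2^k C(2k,k)`. Because `C(6k,3k) ≡ C(2k,k)` modulo `9`, appending a ternary
digit to `n` multiplies `a_n` by a factor that depends only on the parity of `n`, on `n` modulo `3`
and on the new digit. The number `n` is even if its digits are `0` and `2`, odd if there is a single
`1` at the end, and even again once this has become a `11`; following the factors along the
expansion gives `1 + 6 μ(n) + 3 n`, `3` and `6` in these three cases and `0` otherwise. -/

open Polynomial

/-! ### Central Delannoy numbers as polynomial coefficients -/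

theorem coeff_X_add_one_mul_X_add_two_pow {R : Type*} [CommSemiring R] (n : ℕ) :
    (((X + 1) * (X + 2)) ^ n : R[X]).coeff n = aperyNumber 1 1 n := by
  have expansion : ((X + 1) * (X + 2)) ^ n
      = ∑ k ∈ Finset.range (n + 1), C (n.choose k : R) * (X + 1) ^ (n + k) := by
    rw [mul_pow, ← one_add_one_eq_two, ← add_assoc, add_pow (X + 1 : R[X]) 1, Finset.mul_sum]
    refine Finset.sum_congr rfl fun k _ => ?_
    rw [one_pow, mul_one, C_eq_natCast, pow_add]
    ring
  simp only [expansion, finsetSum_coeff, coeff_C_mul, coeff_X_add_one_pow, aperyNumber, pow_one,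
    Nat.choose_symm_add (a := n), Nat.cast_sum, Nat.cast_mul]

theorem X_sq_add_C_pow_eq_expand {R : Type*} [CommSemiring R] (r : R) (n : ℕ) :
    (X ^ 2 + C r) ^ n = expand R 2 ((X + C r) ^ n) := by
  rw [map_pow, map_add, expand_X, expand_C]

theorem coeff_X_sq_add_C_pow_two_mul {R : Type*} [CommSemiring R] (r : R) (n k : ℕ) :
    ((X ^ 2 + C r) ^ n).coeff (2 * k) = r ^ (n - k) * n.choose k := by
  rw [X_sq_add_C_pow_eq_expand, coeff_expand_mul' two_pos, coeff_X_add_C_pow]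

theorem coeff_X_sq_add_C_pow_two_mul_add_one {R : Type*} [CommSemiring R] (r : R) (n k : ℕ) :
    ((X ^ 2 + C r) ^ n).coeff (2 * k + 1) = 0 := by
  rw [X_sq_add_C_pow_eq_expand, coeff_expand two_pos, if_neg (by omega)]

theorem add_pow_of_sq_eq_zero {R : Type*} [CommSemiring R] (x : R) {y : R} (hy : y ^ 2 = 0)
    (n : ℕ) : (x + y) ^ n = x ^ n + n * x ^ (n - 1) * y := by
  obtain ⟨z, hz⟩ := powAddExpansion x y n
  rw [hz, hy, mul_zero, add_zero]

/-! ### Reduction to central binomial coefficients -/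

theorem X_add_one_mul_X_add_two_pow (n : ℕ) : (((X + 1) * (X + 2)) ^ n : (ZMod 9)[X])
    = (X ^ 2 + C 2) ^ n + C (3 * n : ZMod 9) * ((X ^ 2 + C 2) ^ (n - 1) * X) := by
  have three_X_sq : (C 3 * X : (ZMod 9)[X]) ^ 2 = 0 := by
    rw [mul_pow, ← C_pow, show (3 : ZMod 9) ^ 2 = 0 from rfl, C_0, zero_mul]
  have factors : ((X + 1) * (X + 2) : (ZMod 9)[X]) = X ^ 2 + C 2 + C 3 * X := by
    simp only [C_ofNat]
    ring
  rw [factors, add_pow_of_sq_eq_zero _ three_X_sq, C_mul, C_eq_natCast]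
  ring

theorem cast_aperyNumber_two_mul (k : ℕ) :
    (aperyNumber 1 1 (2 * k) : ZMod 9) = 2 ^ k * k.centralBinom := by
  rw [← coeff_X_add_one_mul_X_add_two_pow, X_add_one_mul_X_add_two_pow, coeff_add, coeff_C_mul,
    coeff_X_sq_add_C_pow_two_mul, Nat.centralBinom_eq_two_mul_choose,
    show 2 * k - k = k by omega, add_eq_left]
  cases k with
  | zero => simp
  | succ k =>
    rw [show 2 * (k + 1) = 2 * k + 1 + 1 by ring, coeff_mul_X,
      coeff_X_sq_add_C_pow_two_mul_add_one, mul_zero]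

theorem cast_aperyNumber_two_mul_add_one (k : ℕ) :
    (aperyNumber 1 1 (2 * k + 1) : ZMod 9) = 3 * (2 * k + 1) * (2 ^ k * k.centralBinom) := by
  rw [← coeff_X_add_one_mul_X_add_two_pow, X_add_one_mul_X_add_two_pow, coeff_add, coeff_C_mul,
    coeff_X_sq_add_C_pow_two_mul_add_one, zero_add, coeff_mul_X, Nat.add_sub_cancel,
    coeff_X_sq_add_C_pow_two_mul, Nat.centralBinom_eq_two_mul_choose,
    show 2 * k - k = k by omega]
  push_cast
  rfl

/-! ### Binomial coefficients modulo the square of a prime -/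

theorem prime_dvd_choose_mul {p : ℕ} (hp : p.Prime) (n : ℕ) {k : ℕ} (hk : ¬ p ∣ k) :
    p ∣ (p * n).choose k := by
  have : Fact p.Prime := ⟨hp⟩
  have lucas := Choose.choose_modEq_choose_mod_mul_choose_div_nat (p := p) (n := p * n) (k := k)
  rw [Nat.mul_mod_right, Nat.choose_eq_zero_of_lt
    (Nat.pos_of_ne_zero fun h => hk (Nat.dvd_of_mod_eq_zero h)), zero_mul] at lucas
  exact Nat.modEq_zero_iff_dvd.1 lucas

theorem sq_dvd_choose_mul_mul_choose {p i j : ℕ} (hp : p.Prime) (n : ℕ) (hij : p ∣ i + j)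
    (hj : j ≠ 0) (hjp : j ≠ p) : p ^ 2 ∣ (p * n).choose i * p.choose j := by
  rcases lt_or_gt_of_ne hjp with hlt | hgt
  · have hpj : ¬ p ∣ j := Nat.not_dvd_of_pos_of_lt (Nat.pos_of_ne_zero hj) hlt
    have hpi : ¬ p ∣ i := fun h => hpj ((Nat.dvd_add_right h).1 hij)
    rw [sq]
    exact mul_dvd_mul (prime_dvd_choose_mul hp n hpi) (hp.dvd_choose_self hj hlt)
  · simp [Nat.choose_eq_zero_of_lt hgt]

theorem choose_mul_succ_modEq_add {p : ℕ} (hp : p.Prime) (n k : ℕ) :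
    (p * (n + 1)).choose (p * (k + 1))
      ≡ (p * n).choose (p * k) + (p * n).choose (p * (k + 1)) [MOD p ^ 2] := by
  rw [← ZMod.natCast_eq_natCast_iff, mul_add_one p n, Nat.add_choose_eq, Nat.cast_sum,
    Finset.sum_eq_add_of_mem (p * k, p) (p * (k + 1), 0)
      (by simp [mul_add_one]) (by simp) (by simp [hp.ne_zero])]
  · simp
  · rintro ⟨i, j⟩ hij ⟨hne_p, hne_zero⟩
    rw [Finset.HasAntidiagonal.mem_antidiagonal] at hij
    rw [ZMod.natCast_eq_zero_iff]
    refine sq_dvd_choose_mul_mul_choose hp n ⟨k + 1, hij⟩ ?_ ?_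
    · rintro rfl
      exact hne_zero (by simpa using hij)
    · rintro rfl
      exact hne_p (by simpa [mul_add_one] using hij)

theorem choose_mul_mul_modEq_choose_sq {p : ℕ} (hp : p.Prime) (n k : ℕ) :
    (p * n).choose (p * k) ≡ n.choose k [MOD p ^ 2] := by
  induction n generalizing k with
  | zero =>
    rcases k.eq_zero_or_pos with rfl | hk
    · rfl
    · rw [mul_zero, Nat.choose_eq_zero_of_lt hk, Nat.choose_eq_zero_of_lt (Nat.mul_pos hp.pos hk)]
  | succ n ih =>
    cases k with
    | zero => simp only [mul_zero, Nat.choose_zero_right, Nat.ModEq.refl]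
    | succ k =>
      rw [Nat.choose_succ_succ']
      exact (choose_mul_succ_modEq_add hp n k).trans ((ih k).add (ih (k + 1)))

/-! ### Recurrence modulo nine -/

theorem cast_centralBinom_three_mul (k : ℕ) :
    ((3 * k).centralBinom : ZMod 9) = k.centralBinom := by
  rw [ZMod.natCast_eq_natCast_iff, Nat.centralBinom_eq_two_mul_choose,
    Nat.centralBinom_eq_two_mul_choose, mul_left_comm]
  exact choose_mul_mul_modEq_choose_sq Nat.prime_three (2 * k) k

theorem cast_centralBinom_three_mul_add_one (k : ℕ) :
    ((3 * k + 1).centralBinom : ZMod 9) = 2 * (1 + 3 * k) * k.centralBinom := by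
  have h := congrArg (Nat.cast (R := ZMod 9)) (Nat.succ_mul_centralBinom_succ (3 * k))
  push_cast [cast_centralBinom_three_mul] at h
  -- `1 - 3 k` is the inverse of `3 k + 1`
  linear_combination (norm := (ring_nf; reduce_mod_char)) (1 - 3 * k : ZMod 9) * h

theorem cast_centralBinom_three_mul_add_two (k : ℕ) :
    ((3 * k + 2).centralBinom : ZMod 9) = 3 * (k + 2) * k.centralBinom := by
  have h := congrArg (Nat.cast (R := ZMod 9)) (Nat.succ_mul_centralBinom_succ (3 * k + 1))
  push_cast [cast_centralBinom_three_mul_add_one] at h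
  -- `5 + 6 k` is the inverse of `3 k + 2`
  linear_combination (norm := (ring_nf; reduce_mod_char)) (5 + 6 * k : ZMod 9) * h

theorem two_pow_three_mul (k : ℕ) : (2 : ZMod 9) ^ (3 * k) = (1 + 3 * k) * 2 ^ k := by
  have four_pow : (4 : ZMod 9) ^ k = 1 + 3 * k := by
    rw [show (4 : ZMod 9) = 1 + 3 from rfl, add_pow_of_sq_eq_zero 1 (y := (3 : ZMod 9)) rfl]
    ring
  rw [← four_pow, ← mul_pow, pow_mul]
  rfl

theorem cast_aperyNumber_three_mul_of_even {n : ℕ} (hn : Even n) :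
    (aperyNumber 1 1 (3 * n) : ZMod 9) = (1 + 6 * n) * aperyNumber 1 1 n := by
  obtain ⟨k, rfl⟩ := hn.two_dvd
  rw [mul_left_comm, cast_aperyNumber_two_mul, cast_aperyNumber_two_mul, two_pow_three_mul,
    cast_centralBinom_three_mul]
  push_cast
  ring_nf
  reduce_mod_char

theorem cast_aperyNumber_three_mul_add_one_of_even {n : ℕ} (hn : Even n) :
    (aperyNumber 1 1 (3 * n + 1) : ZMod 9) = 3 * aperyNumber 1 1 n := by
  obtain ⟨k, rfl⟩ := hn.two_dvd
  rw [mul_left_comm, cast_aperyNumber_two_mul, cast_aperyNumber_two_mul_add_one, two_pow_three_mul,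
    cast_centralBinom_three_mul]
  push_cast
  ring_nf
  reduce_mod_char

theorem cast_aperyNumber_three_mul_add_two_of_even {n : ℕ} (hn : Even n) :
    (aperyNumber 1 1 (3 * n + 2) : ZMod 9) = (4 + 3 * n) * aperyNumber 1 1 n := by
  obtain ⟨k, rfl⟩ := hn.two_dvd
  rw [show 3 * (2 * k) + 2 = 2 * (3 * k + 1) by ring, cast_aperyNumber_two_mul,
    cast_aperyNumber_two_mul, pow_succ, two_pow_three_mul, cast_centralBinom_three_mul_add_one]
  push_cast
  ring_nf
  reduce_mod_char

theorem cast_aperyNumber_three_mul_of_odd {n : ℕ} (hn : Odd n) :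
    (aperyNumber 1 1 (3 * n) : ZMod 9) = 0 := by
  obtain ⟨k, rfl⟩ := hn
  rw [show 3 * (2 * k + 1) = 2 * (3 * k + 1) + 1 by ring, cast_aperyNumber_two_mul_add_one]
  push_cast
  ring_nf
  reduce_mod_char

theorem cast_aperyNumber_three_mul_add_one_of_odd {n : ℕ} (hn : Odd n) :
    (aperyNumber 1 1 (3 * n + 1) : ZMod 9) = 2 * aperyNumber 1 1 n := by
  obtain ⟨k, rfl⟩ := hn
  rw [show 3 * (2 * k + 1) + 1 = 2 * (3 * k + 2) by ring, cast_aperyNumber_two_mul,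
    cast_aperyNumber_two_mul_add_one, pow_add, two_pow_three_mul,
    cast_centralBinom_three_mul_add_two]
  ring_nf
  reduce_mod_char

theorem cast_aperyNumber_three_mul_add_two_of_odd {n : ℕ} (hn : Odd n) :
    (aperyNumber 1 1 (3 * n + 2) : ZMod 9) = 0 := by
  obtain ⟨k, rfl⟩ := hn
  rw [show 3 * (2 * k + 1) + 2 = 2 * (3 * k + 2) + 1 by ring, cast_aperyNumber_two_mul_add_one,
    cast_centralBinom_three_mul_add_two]
  push_cast
  ring_nf
  reduce_mod_char

/-! ### Ternary digits -/

@[elab_as_elim]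
theorem ternary_induction {P : ℕ → Prop} (zero : P 0)
    (append_digit : ∀ m i, i < 3 → P m → P (3 * m + i)) (n : ℕ) : P n := by
  induction n using Nat.strong_induction_on with
  | _ n ih =>
    rcases n.eq_zero_or_pos with rfl | hn
    · exact zero
    · rw [← Nat.div_add_mod n 3]
      exact append_digit _ _ (n.mod_lt three_pos) (ih _ (Nat.div_lt_self hn (by norm_num)))

theorem ternaryDigit_eq (n i : ℕ) : ternaryDigit n i = n / 3 ^ i % 3 :=
  Nat.getD_digits n i (by norm_num)

theorem ternaryDigit_zero_left (i : ℕ) : ternaryDigit 0 i = 0 := by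
  rw [ternaryDigit_eq, Nat.zero_div, Nat.zero_mod]

theorem ternaryDigit_zero_right (n : ℕ) : ternaryDigit n 0 = n % 3 := by
  rw [ternaryDigit_eq, pow_zero, Nat.div_one]

theorem lt_length_digits_of_ternaryDigit_eq_two {n i : ℕ} (h : ternaryDigit n i = 2) :
    i < (Nat.digits 3 n).length := by
  by_contra! hle
  rw [ternaryDigit, List.getD_eq_default _ _ hle] at h
  exact absurd h (by norm_num)

theorem onlyZerosAndTwos_zero : OnlyZerosAndTwos 0 := fun i => Or.inl (ternaryDigit_zero_left i)

section AppendDigit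

variable (m : ℕ) {i : ℕ} (hi : i < 3)
include hi

theorem ternaryDigit_three_mul_add_zero : ternaryDigit (3 * m + i) 0 = i := by
  rw [ternaryDigit_zero_right]
  omega

theorem ternaryDigit_three_mul_add_succ (j : ℕ) :
    ternaryDigit (3 * m + i) (j + 1) = ternaryDigit m j := by
  rw [ternaryDigit_eq, ternaryDigit_eq, pow_succ', ← Nat.div_div_eq_div_mul]
  congr 2
  omega

theorem onlyZerosAndTwos_three_mul_add :
    OnlyZerosAndTwos (3 * m + i) ↔ (i = 0 ∨ i = 2) ∧ OnlyZerosAndTwos m := by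
  simp only [OnlyZerosAndTwos]
  rw [← Nat.and_forall_add_one]
  simp only [ternaryDigit_three_mul_add_zero m hi, ternaryDigit_three_mul_add_succ m hi]

theorem lastDigitOne_three_mul_add :
    LastDigitOneOtherwiseZerosAndTwos (3 * m + i) ↔ i = 1 ∧ OnlyZerosAndTwos m := by
  simp only [LastDigitOneOtherwiseZerosAndTwos, OnlyZerosAndTwos]
  rw [← Nat.and_forall_add_one (p := fun j => j ≠ 0 → _)]
  simp [ternaryDigit_three_mul_add_zero m hi, ternaryDigit_three_mul_add_succ m hi]

end AppendDigit

theorem oneOneOnce_iff (n : ℕ) : OneOneOnceOtherwiseZerosAndTwos n ↔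
    ∃ i, OneOneOccursAt n i ∧
      ∀ j, j ≠ i → j ≠ i + 1 → ternaryDigit n j = 0 ∨ ternaryDigit n j = 2 := by
  refine exists_congr fun i => and_congr_right fun _ =>
    and_iff_right_of_imp fun otherwise_zero_two j one_one => ?_
  have mem_of_one {k : ℕ} (hk : ternaryDigit n k = 1) : k = i ∨ k = i + 1 := by
    by_contra! hne
    have := otherwise_zero_two k hne.1 hne.2
    omega
  have := mem_of_one one_one.1
  have := mem_of_one one_one.2
  omega

theorem oneOneOnce_three_mul_add (m : ℕ) {i : ℕ} (hi : i < 3) :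
    OneOneOnceOtherwiseZerosAndTwos (3 * m + i) ↔
      (i = 1 ∧ LastDigitOneOtherwiseZerosAndTwos m) ∨
        ((i = 0 ∨ i = 2) ∧ OneOneOnceOtherwiseZerosAndTwos m) := by
  rw [oneOneOnce_iff, oneOneOnce_iff, ← Nat.or_exists_add_one, ← exists_and_left]
  simp only [OneOneOccursAt, LastDigitOneOtherwiseZerosAndTwos]
  refine or_congr ?_ (exists_congr fun k => ?_)
  · rw [← Nat.and_forall_add_one (p := fun j => j ≠ 0 → _)]
    simp only [zero_add, ternaryDigit_three_mul_add_succ m hi, ternaryDigit_three_mul_add_zero m hi,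
      ne_eq, not_true_eq_false, zero_ne_one, not_false_eq_true, forall_const, IsEmpty.forall_iff,
      Nat.add_eq_zero_iff, one_ne_zero, and_false, Nat.add_eq_right, true_and]
    tauto
  · rw [← Nat.and_forall_add_one (p := fun j => j ≠ k + 1 → _)]
    simp only [ternaryDigit_three_mul_add_succ m hi, ne_eq, Nat.right_eq_add, Nat.add_eq_zero_iff,
      one_ne_zero, and_false, not_false_eq_true, OfNat.ofNat_ne_zero,
      ternaryDigit_three_mul_add_zero m hi, forall_const, Nat.add_right_cancel_iff]
    tauto

/-! ### Maximal strings of twos -/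

theorem exists_start_of_twos {n j : ℕ} (hj : ternaryDigit n j = 2) :
    ∃ i ≤ j, (∀ k ∈ Finset.Icc i j, ternaryDigit n k = 2) ∧
      (i = 0 ∨ ternaryDigit n (i - 1) ≠ 2) := by
  induction j with
  | zero => exact ⟨0, le_rfl, by simpa using hj, Or.inl rfl⟩
  | succ j ih =>
    by_cases hprev : ternaryDigit n j = 2
    · obtain ⟨i, hij, twos, start⟩ := ih hprev
      refine ⟨i, by omega, fun k hk => ?_, start⟩
      rw [← Finset.insert_Icc_right_eq_Icc_add_one (by omega), Finset.mem_insert] at hk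
      rcases hk with rfl | hk
      exacts [hj, twos k hk]
    · exact ⟨j + 1, le_rfl, by simpa using hj, Or.inr hprev⟩

theorem IsMaximalStringOfTwos.start_le {n i i' j : ℕ} (h : IsMaximalStringOfTwos n i j)
    (h' : IsMaximalStringOfTwos n i' j) : i ≤ i' := by
  obtain ⟨hij, -, start, -⟩ := h
  obtain ⟨-, twos, -⟩ := h'
  by_contra! hlt
  rcases start with rfl | hprev
  · omega
  · exact hprev (twos _ (Finset.mem_Icc.2 (by omega)))

theorem numMaximalStringsOfTwos_eq_card_ends (n : ℕ) {N : ℕ}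
    (hN : (Nat.digits 3 n).length ≤ N) :
    numMaximalStringsOfTwos n = ((Finset.range N).filter fun j =>
      ternaryDigit n j = 2 ∧ ternaryDigit n (j + 1) ≠ 2).card := by
  refine Finset.card_bij (fun p _ => p.2) ?_ ?_ ?_
  · rintro ⟨i, j⟩ hp
    obtain ⟨hij, twos, -, hend⟩ := (Finset.mem_filter.1 hp).2
    have hj := twos j (Finset.right_mem_Icc.2 hij)
    exact Finset.mem_filter.2 ⟨Finset.mem_range.2
      ((lt_length_digits_of_ternaryDigit_eq_two hj).trans_le hN), hj, hend⟩
  · rintro ⟨i, j⟩ hp ⟨i', j'⟩ hp' (rfl : j = j')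
    have h := (Finset.mem_filter.1 hp).2
    have h' := (Finset.mem_filter.1 hp').2
    exact Prod.ext (le_antisymm (h.start_le h') (h'.start_le h)) rfl
  · intro j hj
    obtain ⟨-, htwo, hend⟩ := Finset.mem_filter.1 hj
    obtain ⟨i, hij, twos, start⟩ := exists_start_of_twos htwo
    have hlt := lt_length_digits_of_ternaryDigit_eq_two htwo
    exact ⟨(i, j), Finset.mem_filter.2 ⟨Finset.mem_product.2 ⟨Finset.mem_range.2 (hij.trans_lt hlt),
      Finset.mem_range.2 hlt⟩, hij, twos, start, hend⟩, rfl⟩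

theorem numMaximalStringsOfTwos_zero : numMaximalStringsOfTwos 0 = 0 := by
  simp [numMaximalStringsOfTwos]

theorem numMaximalStringsOfTwos_three_mul_add (m : ℕ) {i : ℕ} (hi : i < 3) :
    numMaximalStringsOfTwos (3 * m + i) = numMaximalStringsOfTwos m
      + if i = 2 ∧ m % 3 ≠ 2 then 1 else 0 := by
  set N := (Nat.digits 3 m).length + (Nat.digits 3 (3 * m + i)).length
  rw [numMaximalStringsOfTwos_eq_card_ends (3 * m + i) (N := N + 1) (by omega),
    numMaximalStringsOfTwos_eq_card_ends m (N := N) (by omega), Finset.card_filter,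
    Finset.card_filter, Finset.sum_range_succ']
  simp only [ternaryDigit_three_mul_add_zero m hi, ternaryDigit_three_mul_add_succ m hi,
    ternaryDigit_zero_right]

/-! ### Residues modulo nine -/

theorem OnlyZerosAndTwos.even {n : ℕ} (hn : OnlyZerosAndTwos n) : Even n := by
  induction n using ternary_induction with
  | zero => exact Even.zero
  | append_digit m i hi ih =>
    obtain ⟨rfl | rfl, hm⟩ := (onlyZerosAndTwos_three_mul_add m hi).1 hn
    exacts [(ih hm).mul_left 3, ((ih hm).mul_left 3).add even_two]

theorem LastDigitOneOtherwiseZerosAndTwos.odd {n : ℕ}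
    (hn : LastDigitOneOtherwiseZerosAndTwos n) : Odd n := by
  rw [← Nat.div_add_mod n 3, lastDigitOne_three_mul_add _ (n.mod_lt three_pos)] at hn
  rw [← Nat.div_add_mod n 3, hn.1]
  exact (hn.2.even.mul_left 3).add_one

theorem OneOneOnceOtherwiseZerosAndTwos.even {n : ℕ}
    (hn : OneOneOnceOtherwiseZerosAndTwos n) : Even n := by
  induction n using ternary_induction with
  | zero => exact Even.zero
  | append_digit m i hi ih =>
    obtain ⟨rfl, hm⟩ | ⟨rfl | rfl, hm⟩ := (oneOneOnce_three_mul_add m hi).1 hn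
    · exact ((Nat.odd_iff.2 rfl : Odd 3).mul hm.odd).add_one
    · exact (ih hm).mul_left 3
    · exact ((ih hm).mul_left 3).add even_two

theorem OnlyZerosAndTwos.mod_three {n : ℕ} (hn : OnlyZerosAndTwos n) : n % 3 = 0 ∨ n % 3 = 2 := by
  simpa only [ternaryDigit_zero_right] using hn 0

theorem three_mul_natCast_mod_three (n : ℕ) : (3 * (n % 3 : ℕ) : ZMod 9) = 3 * n := by
  have h : 3 * (n % 3) ≡ 3 * n [MOD 3 * 3] := (Nat.mod_modEq n 3).mul_left' 3
  exact_mod_cast (ZMod.natCast_eq_natCast_iff _ _ 9).2 h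

theorem OnlyZerosAndTwos.cast_aperyNumber {n : ℕ} (hn : OnlyZerosAndTwos n) :
    (aperyNumber 1 1 n : ZMod 9) = 1 + 6 * numMaximalStringsOfTwos n + 3 * n := by
  induction n using ternary_induction with
  | zero => simp [aperyNumber, numMaximalStringsOfTwos_zero]
  | append_digit m i hi ih =>
    obtain ⟨rfl | rfl, hm⟩ := (onlyZerosAndTwos_three_mul_add m hi).1 hn
    · rw [numMaximalStringsOfTwos_three_mul_add m hi, if_neg (by simp), add_zero, add_zero,
        cast_aperyNumber_three_mul_of_even hm.even, ih hm]
      push_cast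
      ring_nf
      reduce_mod_char
    · have three_mul_mod := three_mul_natCast_mod_three m
      rw [numMaximalStringsOfTwos_three_mul_add m hi,
        cast_aperyNumber_three_mul_add_two_of_even hm.even, ih hm]
      rcases hm.mod_three with hmod | hmod <;> rw [hmod] at three_mul_mod
      · rw [if_pos ⟨rfl, by omega⟩]
        push_cast at three_mul_mod ⊢
        linear_combination (norm := (ring_nf; reduce_mod_char)) -2 * three_mul_mod
      · rw [if_neg (by omega)]
        push_cast at three_mul_mod ⊢
        linear_combination (norm := (ring_nf; reduce_mod_char)) -2 * three_mul_mod

theorem LastDigitOneOtherwiseZerosAndTwos.cast_aperyNumber {n : ℕ}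
    (hn : LastDigitOneOtherwiseZerosAndTwos n) : (aperyNumber 1 1 n : ZMod 9) = 3 := by
  rw [← Nat.div_add_mod n 3, lastDigitOne_three_mul_add _ (n.mod_lt three_pos)] at hn
  obtain ⟨hlast, hm⟩ := hn
  rw [← Nat.div_add_mod n 3, hlast, cast_aperyNumber_three_mul_add_one_of_even hm.even,
    hm.cast_aperyNumber]
  ring_nf
  reduce_mod_char

theorem OneOneOnceOtherwiseZerosAndTwos.cast_aperyNumber {n : ℕ}
    (hn : OneOneOnceOtherwiseZerosAndTwos n) : (aperyNumber 1 1 n : ZMod 9) = 6 := by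
  induction n using ternary_induction with
  | zero =>
    obtain ⟨i, ⟨-, hone⟩, -⟩ := hn
    exact absurd hone (by simp [ternaryDigit_zero_left])
  | append_digit m i hi ih =>
    obtain ⟨rfl, hm⟩ | ⟨rfl | rfl, hm⟩ := (oneOneOnce_three_mul_add m hi).1 hn
    · rw [cast_aperyNumber_three_mul_add_one_of_odd hm.odd, hm.cast_aperyNumber]
      rfl
    · rw [add_zero, cast_aperyNumber_three_mul_of_even hm.even, ih hm]
      ring_nf
      reduce_mod_char
    · rw [cast_aperyNumber_three_mul_add_two_of_even hm.even, ih hm]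
      ring_nf
      reduce_mod_char

theorem cast_aperyNumber_three_mul_add_eq_zero {m : ℕ} (hm : (aperyNumber 1 1 m : ZMod 9) = 0)
    {i : ℕ} (hi : i < 3) : (aperyNumber 1 1 (3 * m + i) : ZMod 9) = 0 := by
  rcases m.even_or_odd with heven | hodd <;> interval_cases i
  · rw [add_zero, cast_aperyNumber_three_mul_of_even heven, hm, mul_zero]
  · rw [cast_aperyNumber_three_mul_add_one_of_even heven, hm, mul_zero]
  · rw [cast_aperyNumber_three_mul_add_two_of_even heven, hm, mul_zero]
  · rw [add_zero, cast_aperyNumber_three_mul_of_odd hodd]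
  · rw [cast_aperyNumber_three_mul_add_one_of_odd hodd, hm, mul_zero]
  · rw [cast_aperyNumber_three_mul_add_two_of_odd hodd]

theorem cast_aperyNumber_eq_zero {n : ℕ} (not_zero_two : ¬ OnlyZerosAndTwos n)
    (not_last_one : ¬ LastDigitOneOtherwiseZerosAndTwos n)
    (not_one_one : ¬ OneOneOnceOtherwiseZerosAndTwos n) :
    (aperyNumber 1 1 n : ZMod 9) = 0 := by
  induction n using ternary_induction with
  | zero => exact absurd onlyZerosAndTwos_zero not_zero_two
  | append_digit m i hi ih =>
    rw [onlyZerosAndTwos_three_mul_add m hi] at not_zero_two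
    rw [lastDigitOne_three_mul_add m hi] at not_last_one
    rw [oneOneOnce_three_mul_add m hi] at not_one_one
    by_cases zero_two : OnlyZerosAndTwos m
    · grind
    by_cases last_one : LastDigitOneOtherwiseZerosAndTwos m
    · obtain rfl | rfl : i = 0 ∨ i = 2 := by grind
      · exact cast_aperyNumber_three_mul_of_odd last_one.odd
      · exact cast_aperyNumber_three_mul_add_two_of_odd last_one.odd
    by_cases one_one : OneOneOnceOtherwiseZerosAndTwos m
    · obtain rfl : i = 1 := by grind
      rw [cast_aperyNumber_three_mul_add_one_of_even one_one.even, one_one.cast_aperyNumber]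
      rfl
    · exact cast_aperyNumber_three_mul_add_eq_zero (ih zero_two last_one one_one) hi

theorem mainTheorem8 (n : ℕ) :
    (aperyNumber 1 1 n ≡ 1 [MOD 9] ↔
      OnlyZerosAndTwos n ∧ numMaximalStringsOfTwos n ≡ ternaryDigit n 0 [MOD 3]) ∧
    (aperyNumber 1 1 n ≡ 3 [MOD 9] ↔ LastDigitOneOtherwiseZerosAndTwos n) ∧
    (aperyNumber 1 1 n ≡ 4 [MOD 9] ↔
      OnlyZerosAndTwos n ∧ numMaximalStringsOfTwos n ≡ ternaryDigit n 0 + 2 [MOD 3]) ∧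
    (aperyNumber 1 1 n ≡ 6 [MOD 9] ↔ OneOneOnceOtherwiseZerosAndTwos n) ∧
    (aperyNumber 1 1 n ≡ 7 [MOD 9] ↔
      OnlyZerosAndTwos n ∧ numMaximalStringsOfTwos n ≡ ternaryDigit n 0 + 1 [MOD 3]) ∧
    (¬ (OnlyZerosAndTwos n ∧ numMaximalStringsOfTwos n ≡ ternaryDigit n 0 [MOD 3]) →
      ¬ LastDigitOneOtherwiseZerosAndTwos n →
      ¬ (OnlyZerosAndTwos n ∧ numMaximalStringsOfTwos n ≡ ternaryDigit n 0 + 2 [MOD 3]) →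
      ¬ OneOneOnceOtherwiseZerosAndTwos n →
      ¬ (OnlyZerosAndTwos n ∧ numMaximalStringsOfTwos n ≡ ternaryDigit n 0 + 1 [MOD 3]) →
      9 ∣ aperyNumber 1 1 n) ∧
    (¬ aperyNumber 1 1 n ≡ 2 [MOD 9] ∧ ¬ aperyNumber 1 1 n ≡ 5 [MOD 9] ∧
      ¬ aperyNumber 1 1 n ≡ 8 [MOD 9]) := by
  have zero_two (h : OnlyZerosAndTwos n) :
      aperyNumber 1 1 n ≡ 1 + 6 * numMaximalStringsOfTwos n + 3 * n [MOD 9] :=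
    (ZMod.natCast_eq_natCast_iff _ _ 9).1 (by exact_mod_cast h.cast_aperyNumber)
  have last_one (h : LastDigitOneOtherwiseZerosAndTwos n) : aperyNumber 1 1 n ≡ 3 [MOD 9] :=
    (ZMod.natCast_eq_natCast_iff _ _ 9).1 h.cast_aperyNumber
  have one_one (h : OneOneOnceOtherwiseZerosAndTwos n) : aperyNumber 1 1 n ≡ 6 [MOD 9] :=
    (ZMod.natCast_eq_natCast_iff _ _ 9).1 h.cast_aperyNumber
  have otherwise (h₁ : ¬ OnlyZerosAndTwos n) (h₂ : ¬ LastDigitOneOtherwiseZerosAndTwos n)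
      (h₃ : ¬ OneOneOnceOtherwiseZerosAndTwos n) : 9 ∣ aperyNumber 1 1 n :=
    (ZMod.natCast_eq_zero_iff _ 9).1 (cast_aperyNumber_eq_zero h₁ h₂ h₃)
  rw [ternaryDigit_zero_right]
  simp only [Nat.ModEq, Nat.dvd_iff_mod_eq_zero] at *
  by_cases h₁ : OnlyZerosAndTwos n <;> by_cases h₂ : LastDigitOneOtherwiseZerosAndTwos n <;>
    by_cases h₃ : OneOneOnceOtherwiseZerosAndTwos n <;>
    simp only [h₁, h₂, h₃, not_true_eq_false, not_false_eq_true, true_imp_iff, false_imp_iff,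
      true_and, false_and, implies_true, iff_true, iff_false] at * <;>
    and_intros <;> intros <;> omega
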